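/- Let $K$ be a field and let $\Gamma=(\Gamma_0,\Gamma_1,\mu,\mathfrak o)$ be a Brauer configuration: $\Gamma_0$ is a finite set of vertices; $\Gamma_1$ is a finite collection of labeled finite multisets of vertices, called polygons (different polygons may be equal as multisets); $\mu:\Gamma_0\to\mathbb Z_{>0}$ is a multiplicity function. Write $\mathrm{occ}(\alpha,V)$ for the number of times that $\alpha$ occurs in the polygon $V$, $\mathrm{val}(\alpha)=\sum_{V\in\Gamma_1}\mathrm{occ}(\alpha,V)$, and $\overline V$ for the set of vertices that occur in $V$; $\alpha$ is truncated if $\mathrm{val}(\alpha)=\mu(\alpha)=1$. The orientation $\mathfrak o$ chooses, at each nontruncated vertex $\alpha$, a cyclic ordering $V_1<\dots<V_t\,(<V_1)$, $t=\mathrm{val}(\alpha)$, of the list of polygons that contain $\alpha$, in which each $V$ is listed $\mathrm{occ}(\alpha,V)$ times. It is required that every vertex occurs in some polygon, that every polygon has at least two vertices (counted with repetitions), and that every polygon contains a vertex $\alpha$ with $\mathrm{val}(\alpha)\mu(\alpha)>1$. Let $\mathcal Q$ be the induced quiver: it has one vertex $v$ for each polygon $V$, and for each nontruncated $\alpha$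 and each position $j$ of its cyclic ordering one arrow $a^{(\alpha)}_j$ from $v_j$ to $v_{j+1}$ (indices modulo $t$). The cycles $C_l=a^{(\alpha)}_l a^{(\alpha)}_{l+1}\cdots a^{(\alpha)}_{l-1}$ of length $t=\mathrm{val}(\alpha)$ are the special $\alpha$-cycles, $C_l$ being one at $v_l$. The Brauer configuration algebra is $\Lambda=K\mathcal Q/I$, where paths are composed from left to right and $I$ is the two-sided ideal generated by 1. all $C^{\mu(\alpha)}-D^{\mu(\beta)}$, where $C$ is a special $\alpha$-cycle and $D$ a special $\beta$-cycle at the same vertex of $\mathcal Q$; 2. all $C^{\mu(\alpha)}f(C)$, where $C$ is a special $\alpha$-cycle and $f(C)$ is its first arrow; 3. all paths $ab$ of length two that are not a subpath of any special cycle, except the squares $a^2$ of the loops $a$ induced by a vertex $\alpha$ with $\mathrm{val}(\alpha)=1$ and $\mu(\alpha)>1$. Let $V\neq W$ be distinct polygons in $\Gamma_1$ with associated vertices $v,w$ of $\mathcal Q$, regarded also as idempotents of $\Lambda$. Then the $K$-vector space $v\Lambda w$ is finite-dimensional and $$\dim_K v\Lambda w=\sum_{\alpha\in\overline V\cap\overline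 W}\mu(\alpha)\,\mathrm{occ}(\alpha,V)\,\mathrm{occ}(\alpha,W).$$ -/

import Mathlib

/-! ## The path algebra of a quiver with finitely many vertices -/

section PathAlgebra

/-- The paths of a quiver (the trivial ones included) together with their two end points. -/
abbrev Quiver.AnyPath (Q : Type*) [Quiver Q] := Σ v w : Q, Quiver.Path v w

/-- The path algebra `K Q`: the `K`-vector space with basis the set of all paths of `Q`. -/
def PathAlgebra (K Q : Type*) [Field K] [Quiver Q] := Quiver.AnyPath Q →₀ K

namespace PathAlgebra

variable (K : Type*) {Q : Type*} [Field K] [Quiver Q]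

noncomputable instance : AddCommGroup (PathAlgebra K Q) :=
  inferInstanceAs (AddCommGroup (Quiver.AnyPath Q →₀ K))

noncomputable instance : Module K (PathAlgebra K Q) :=
  inferInstanceAs (Module K (Quiver.AnyPath Q →₀ K))

/-- A path, seen as a basis element of the path algebra. -/
noncomputable def ofAnyPath (p : Quiver.AnyPath Q) : PathAlgebra K Q := Finsupp.single p 1

/-- A path from `v` to `w`, seen as a basis element of the path algebra. -/
noncomputable def ofPath {v w : Q} (p : Quiver.Path v w) : PathAlgebra K Q :=
  ofAnyPath K ⟨v, w, p⟩

/-- The basis of the path algebra formed by the paths. -/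
noncomputable def pathBasis : Module.Basis (Quiver.AnyPath Q) K (PathAlgebra K Q) :=
  Module.Basis.ofRepr (LinearEquiv.refl K (Quiver.AnyPath Q →₀ K))

theorem pathBasis_apply (p : Quiver.AnyPath Q) : pathBasis K p = ofAnyPath K p := rfl

open Classical in
/-- The product of two paths: first `p`, then `q`, if `q` starts where `p` ends, and `0`
otherwise. -/
noncomputable def mulPath (p q : Quiver.AnyPath Q) : PathAlgebra K Q :=
  if h : q.1 = p.2.1 then ofPath K (p.2.2.comp (q.2.2.cast h rfl)) else 0

theorem mulPath_comp {u v w : Q} (p : Quiver.Path u v) (q : Quiver.Path v w) :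
    mulPath K ⟨u, v, p⟩ ⟨v, w, q⟩ = ofPath K (p.comp q) := by
  simp [mulPath]

theorem mulPath_of_ne {p q : Quiver.AnyPath Q} (h : q.1 ≠ p.2.1) : mulPath K p q = 0 := by
  simp [mulPath, h]

/-- The multiplication of the path algebra: the bilinear extension of the product of paths. -/
noncomputable def mulHom : PathAlgebra K Q →ₗ[K] PathAlgebra K Q →ₗ[K] PathAlgebra K Q :=
  (pathBasis K).constr K fun p => (pathBasis K).constr K fun q => mulPath K p q

noncomputable instance : Mul (PathAlgebra K Q) := ⟨fun f g => mulHom K f g⟩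

theorem mul_def (f g : PathAlgebra K Q) : f * g = mulHom K f g := rfl

theorem ofAnyPath_mul (p q : Quiver.AnyPath Q) :
    ofAnyPath K p * ofAnyPath K q = mulPath K p q := by
  simp [mul_def, mulHom, ← pathBasis_apply, Module.Basis.constr_basis]

theorem ofPath_mul_ofPath {u v w : Q} (p : Quiver.Path u v) (q : Quiver.Path v w) :
    ofPath K p * ofPath K q = ofPath K (p.comp q) := by
  rw [ofPath, ofPath, ofAnyPath_mul, mulPath_comp]

theorem ofPath_mul_of_ne {u v v' w : Q} (p : Quiver.Path u v) (q : Quiver.Path v' w)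
    (h : v' ≠ v) : ofPath K p * ofPath K q = 0 := by
  rw [ofPath, ofPath, ofAnyPath_mul, mulPath_of_ne]
  exact h

theorem induction_on {P : PathAlgebra K Q → Prop} (f : PathAlgebra K Q)
    (path : ∀ p : Quiver.AnyPath Q, P (ofAnyPath K p)) (zero : P 0)
    (add : ∀ f g, P f → P g → P (f + g)) (smul : ∀ (c : K) f, P f → P (c • f)) : P f := by
  have hf : f ∈ Submodule.span K (Set.range (pathBasis K (Q := Q))) := by
    rw [(pathBasis K (Q := Q)).span_eq]; trivial
  induction hf using Submodule.span_induction with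
  | mem x hx => obtain ⟨p, rfl⟩ := hx; exact path p
  | zero => exact zero
  | add x y _ _ hx hy => exact add x y hx hy
  | smul c x _ hx => exact smul c x hx

theorem path_assoc (p q r : Quiver.AnyPath Q) :
    ofAnyPath K p * ofAnyPath K q * ofAnyPath K r
      = ofAnyPath K p * (ofAnyPath K q * ofAnyPath K r) := by
  obtain ⟨a, b, p⟩ := p
  obtain ⟨c, d, q⟩ := q
  obtain ⟨e, f, r⟩ := r
  change ofPath K p * ofPath K q * ofPath K r = ofPath K p * (ofPath K q * ofPath K r)
  have h0 (x : PathAlgebra K Q) : x * 0 = 0 := by simp [mul_def]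
  have h1 (x : PathAlgebra K Q) : 0 * x = 0 := by simp [mul_def]
  by_cases hbc : c = b
  · subst hbc
    by_cases hde : e = d
    · subst hde
      simp only [ofPath_mul_ofPath, Quiver.Path.comp_assoc]
    · rw [ofPath_mul_of_ne K q r hde, ofPath_mul_ofPath, ofPath_mul_of_ne K _ r hde, h0]
  · rw [ofPath_mul_of_ne K p q hbc, h1]
    by_cases hde : e = d
    · subst hde
      rw [ofPath_mul_ofPath, ofPath_mul_of_ne K p _ hbc]
    · rw [ofPath_mul_of_ne K q r hde, h0]

protected theorem mul_assoc (f g h : PathAlgebra K Q) : f * g * h = f * (g * h) := by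
  induction f using induction_on K with
  | zero => simp [mul_def]
  | add x y hx hy => simp only [mul_def, map_add, LinearMap.add_apply] at *; rw [hx, hy]
  | smul c x hx => simp only [mul_def, map_smul, LinearMap.smul_apply] at *; rw [hx]
  | path p =>
  induction g using induction_on K with
  | zero => simp [mul_def]
  | add x y hx hy => simp only [mul_def, map_add, LinearMap.add_apply] at *; rw [hx, hy]
  | smul c x hx => simp only [mul_def, map_smul, LinearMap.smul_apply] at *; rw [hx]
  | path q =>
  induction h using induction_on K with
  | zero => simp [mul_def]
  | add x y hx hy => simp only [mul_def, map_add] at *; rw [hx, hy]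
  | smul c x hx => simp only [mul_def, map_smul] at *; rw [hx]
  | path r => exact path_assoc K p q r

variable [Fintype Q]

/-- The unit of the path algebra is the sum of all trivial paths. -/
noncomputable instance : One (PathAlgebra K Q) :=
  ⟨∑ v : Q, ofPath K (Quiver.Path.nil : Quiver.Path v v)⟩

theorem one_def :
    (1 : PathAlgebra K Q) = ∑ v : Q, ofPath K (Quiver.Path.nil : Quiver.Path v v) := rfl

protected theorem one_mul (f : PathAlgebra K Q) : 1 * f = f := by
  induction f using induction_on K with
  | zero => simp [mul_def]
  | add x y hx hy => simp only [mul_def, map_add] at *; rw [hx, hy]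
  | smul c x hx => simp only [mul_def, map_smul] at *; rw [hx]
  | path p =>
  obtain ⟨a, b, p⟩ := p
  change 1 * ofPath K p = ofPath K p
  rw [one_def, mul_def, map_sum, LinearMap.sum_apply, Finset.sum_eq_single a]
  · rw [← mul_def, ofPath_mul_ofPath, Quiver.Path.nil_comp]
  · intro v _ hv
    rw [← mul_def, ofPath_mul_of_ne K _ _ (Ne.symm hv)]
  · simp

protected theorem mul_one (f : PathAlgebra K Q) : f * 1 = f := by
  induction f using induction_on K with
  | zero => simp [mul_def]
  | add x y hx hy => simp only [mul_def, map_add, LinearMap.add_apply] at *; rw [hx, hy]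
  | smul c x hx => simp only [mul_def, map_smul, LinearMap.smul_apply] at *; rw [hx]
  | path p =>
  obtain ⟨a, b, p⟩ := p
  change ofPath K p * 1 = ofPath K p
  rw [one_def, mul_def, map_sum, Finset.sum_eq_single b]
  · rw [← mul_def, ofPath_mul_ofPath, Quiver.Path.comp_nil]
  · intro v _ hv
    rw [← mul_def, ofPath_mul_of_ne K _ _ hv]
  · simp

noncomputable instance : Ring (PathAlgebra K Q) where
  __ := (inferInstance : AddCommGroup (PathAlgebra K Q))
  __ := (inferInstance : Mul (PathAlgebra K Q))
  __ := (inferInstance : One (PathAlgebra K Q))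
  left_distrib f g h := by simp [mul_def]
  right_distrib f g h := by simp [mul_def]
  zero_mul f := by simp [mul_def]
  mul_zero f := by simp [mul_def]
  mul_assoc := PathAlgebra.mul_assoc K
  one_mul := PathAlgebra.one_mul K
  mul_one := PathAlgebra.mul_one K

noncomputable instance : Algebra K (PathAlgebra K Q) :=
  Algebra.ofModule (fun c f g => by simp [mul_def]) (fun c f g => by simp [mul_def])

end PathAlgebra

end PathAlgebra

/-! ## Brauer configurations -/

/-- A Brauer configuration with set of vertices `Γ₀` and set of (labels of) polygons `Γ₁`. -/
structure BrauerConfiguration (Γ₀ Γ₁ : Type*) [Fintype Γ₀] [DecidableEq Γ₀]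
    [Fintype Γ₁] [DecidableEq Γ₁] where
  /-- The multiset of vertices that forms a polygon. Different polygons may have the same
  multiset of vertices. -/
  polygon : Γ₁ → Multiset Γ₀
  /-- The multiplicity function. -/
  mult : Γ₀ → ℕ
  mult_pos : ∀ α, 0 < mult α
  /-- The orientation, given at each vertex `α` by a successor sequence `V₁ < ⋯ < V_t`, which is
  read cyclically. (At a vertex that occurs only once, in particular at a truncated one,
  there is only one such sequence, so nothing is chosen there.) -/
  succSeq : Γ₀ → List Γ₁
  /-- A polygon appears in the successor sequence at `α` as often as `α` occurs in it. -/
  count_succSeq : ∀ α V, (succSeq α).count V = (polygon V).count α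
  /-- Every vertex is a vertex of some polygon. -/
  exists_mem_polygon : ∀ α, ∃ V, α ∈ polygon V
  /-- Every polygon has at least two vertices, counted with repetitions. -/
  two_le_card : ∀ V, 2 ≤ (polygon V).card
  /-- Every polygon has a vertex `α` with `val(α) μ(α) > 1`. -/
  exists_one_lt : ∀ V, ∃ α ∈ polygon V, 1 < (∑ W, (polygon W).count α) * mult α

namespace BrauerConfiguration

variable {Γ₀ Γ₁ : Type*} [Fintype Γ₀] [DecidableEq Γ₀] [Fintype Γ₁] [DecidableEq Γ₁]
variable (Γ : BrauerConfiguration Γ₀ Γ₁)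

/-- `occ(α, V)`: the number of times that the vertex `α` occurs in the polygon `V`. -/
def occ (α : Γ₀) (V : Γ₁) : ℕ := (Γ.polygon V).count α

/-- The valency of a vertex. -/
def val (α : Γ₀) : ℕ := ∑ V, Γ.occ α V

/-- The set of the vertices that occur in the polygon `V`. -/
def vertexSet (V : Γ₁) : Finset Γ₀ := (Γ.polygon V).toFinset

/-- A vertex `α` is truncated if `val(α) = μ(α) = 1`. -/
def IsTruncated (α : Γ₀) : Prop := Γ.val α = 1 ∧ Γ.mult α = 1

/-- The successor sequence at `α` has `val(α)` terms. -/
theorem length_succSeq (α : Γ₀) : (Γ.succSeq α).length = Γ.val α := by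
  rw [← Multiset.coe_card, ← Multiset.sum_count_eq_card (s := Finset.univ) (by simp)]
  simp only [Multiset.coe_count, Γ.count_succSeq]
  rfl

/-! ### The induced quiver -/

/-- An arrow of the induced quiver: it is given by a nontruncated vertex `α` and a position in the
successor sequence at `α`, and it goes from the polygon at this position to its successor. -/
structure Arrow where
  vertex : Γ₀
  not_truncated : ¬ Γ.IsTruncated vertex
  pos : Fin (Γ.succSeq vertex).length

namespace Arrow

variable {Γ}

/-- The next arrow, in the cyclic order at the same vertex `α`. -/
def next (a : Γ.Arrow) : Γ.Arrow where
  vertex := a.vertex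
  not_truncated := a.not_truncated
  pos := ⟨(a.pos + 1) % (Γ.succSeq a.vertex).length, Nat.mod_lt _ (by have := a.pos.2; omega)⟩

/-- The arrow that is `n` steps after `a`. -/
def nextN (a : Γ.Arrow) : ℕ → Γ.Arrow
  | 0 => a
  | n + 1 => (a.nextN n).next

/-- The polygon where an arrow starts. -/
def source (a : Γ.Arrow) : Γ₁ := (Γ.succSeq a.vertex).get a.pos

/-- The polygon where an arrow ends: the successor of the polygon where it starts. -/
def target (a : Γ.Arrow) : Γ₁ := a.next.source

end Arrow

/-- The set of vertices of the induced quiver: one for each polygon. -/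
def QVertex (_Γ : BrauerConfiguration Γ₀ Γ₁) := Γ₁

instance : Fintype Γ.QVertex := inferInstanceAs (Fintype Γ₁)

/-- The vertex of the induced quiver that is associated to the polygon `V`. -/
def toQVertex (V : Γ₁) : Γ.QVertex := V

/-- The induced quiver. -/
instance : Quiver Γ.QVertex where
  Hom v w := {a : Γ.Arrow // Γ.toQVertex a.source = v ∧ Γ.toQVertex a.target = w}

namespace Arrow

variable {Γ}

/-- An arrow as an arrow of the induced quiver. -/
def hom (a : Γ.Arrow) : Γ.toQVertex a.source ⟶ Γ.toQVertex a.target := ⟨a, rfl, rfl⟩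

/-- The path formed by `n` consecutive arrows at the same vertex `α`, the first one being `a`. -/
def run (a : Γ.Arrow) : (n : ℕ) →
    Quiver.Path (Γ.toQVertex a.source) (Γ.toQVertex (a.nextN n).source)
  | 0 => Quiver.Path.nil
  | n + 1 => (a.run n).cons (a.nextN n).hom

/-- The special `α`-cycle whose first arrow is `a`, where `α` is the vertex that induces `a`.
It is a special `α`-cycle at the vertex where `a` starts. -/
def specialCycle (a : Γ.Arrow) :
    Quiver.Path (Γ.toQVertex a.source) (Γ.toQVertex (a.nextN (Γ.val a.vertex)).source) :=
  a.run (Γ.val a.vertex)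

theorem nextN_vertex (a : Γ.Arrow) (n : ℕ) : (a.nextN n).vertex = a.vertex := by
  induction n with
  | zero => rfl
  | succ n ih => exact ih

theorem nextN_eq (a : Γ.Arrow) (n : ℕ) : a.nextN n =
    ⟨a.vertex, a.not_truncated, ⟨(a.pos + n) % (Γ.succSeq a.vertex).length,
      Nat.mod_lt _ (by have := a.pos.2; omega)⟩⟩ := by
  induction n with
  | zero => cases a; simp [nextN, Nat.mod_eq_of_lt]
  | succ n ih => rw [nextN, ih]; simp [next, Nat.add_assoc]

/-- The special cycles are closed. -/
theorem nextN_val (a : Γ.Arrow) : a.nextN (Γ.val a.vertex) = a := by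
  rw [nextN_eq]
  cases a
  simp [← length_succSeq, Nat.mod_eq_of_lt]

end Arrow

/-- `p` is a subpath of `q`. -/
def IsSubpath {u v w z : Γ.QVertex} (p : Quiver.Path u v) (q : Quiver.Path w z) : Prop :=
  ∃ (r : Quiver.Path w u) (s : Quiver.Path v z), q = (r.comp p).comp s

/-! ### The Brauer configuration algebra -/

section Algebra

variable (K : Type*) [Field K]

/-- The element `C ^ μ(α)` of the path algebra, where `C` is the special `α`-cycle with first
arrow `a`. -/
noncomputable def cyclePow (a : Γ.Arrow) : PathAlgebra K Γ.QVertex :=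
  PathAlgebra.ofPath K a.specialCycle ^ Γ.mult a.vertex

/-- Relations of type one: `C ^ μ(α) - D ^ μ(β)`, where `C` is a special `α`-cycle and `D` a special
`β`-cycle at the same vertex of the quiver. -/
def relOne : Set (PathAlgebra K Γ.QVertex) :=
  {x | ∃ a b : Γ.Arrow, a.source = b.source ∧ x = Γ.cyclePow K a - Γ.cyclePow K b}

/-- Relations of type two: `C ^ μ(α) f(C)`, where `C` is a special `α`-cycle and `f(C)` is its first
arrow. -/
def relTwo : Set (PathAlgebra K Γ.QVertex) :=
  {x | ∃ a : Γ.Arrow, x = Γ.cyclePow K a * PathAlgebra.ofPath K a.hom.toPath}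

/-- Relations of type three: the paths `ab` of length two which are not a subpath of any special
cycle, except for the squares `aa` of the loops `a` that are special cycles, that is, which are
induced by a vertex `α` with `val(α) = 1` and `μ(α) > 1`. -/
def relThree : Set (PathAlgebra K Γ.QVertex) :=
  {x | ∃ (u v w : Γ.QVertex) (a : u ⟶ v) (b : v ⟶ w),
    (∀ c : Γ.Arrow, ¬ Γ.IsSubpath (a.toPath.comp b.toPath) c.specialCycle) ∧
    ¬ (a.1 = b.1 ∧ Γ.val a.1.vertex = 1) ∧
    x = PathAlgebra.ofPath K (a.toPath.comp b.toPath)}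

/-- The ideal of the path algebra generated by the relations of the three types. -/
noncomputable def relIdeal : TwoSidedIdeal (PathAlgebra K Γ.QVertex) :=
  TwoSidedIdeal.span (Γ.relOne K ∪ Γ.relTwo K ∪ Γ.relThree K)

/-- The Brauer configuration algebra `Λ = K Q / I`. -/
abbrev BrauerAlgebra := PathAlgebra K Γ.QVertex ⧸ (Γ.relIdeal K).asIdeal

/-- The idempotent of `Λ` given by the trivial path at the vertex `v` associated to `V`. -/
noncomputable def idem (V : Γ₁) : Γ.BrauerAlgebra K :=
  Ideal.Quotient.mk _ (PathAlgebra.ofPath K (Quiver.Path.nil : Quiver.Path (Γ.toQVertex V) _))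

/-- The `K`-subspace `v Λ w` of `Λ`: the set of all elements `v x w` with `x` in `Λ`. -/
noncomputable def corner (V W : Γ₁) : Submodule K (Γ.BrauerAlgebra K) :=
  LinearMap.range (LinearMap.mulLeftRight K (Γ.idem K V, Γ.idem K W))

end Algebra

end BrauerConfiguration

/-!
The product of the classes of two paths is the class of a path or zero, so `v Λ w` is spanned by the
classes of the paths from `v` to `w`. Call a path a *short run* if it consists of consecutive arrows
at one vertex `α` and has length less than `μ(α) val(α)`. When `v ≠ w`, the short runs from `v` to
`w` form a basis of `v Λ w`, and counting them gives the formula.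

* Spanning (`ofPath_mem_relIdeal`): a path that is not a short run either contains two successive
  arrows that are not consecutive, hence a relation of type three, or it is a run at a vertex `α` of
  length at least `μ(α) val(α)`. Equality is impossible because `C ^ μ(α)` is closed and `v ≠ w`, so
  the path starts with a relation of type two, `C ^ μ(α) f(C)`.
* Independence (`mem_longSpan_of_mem_relIdeal`): subpaths of short runs are short runs, so the
  span of all other paths is an ideal of the path algebra. It contains all the relations, as both
  terms of a relation of type one are runs of length `μ(α) val(α)`. Hence it contains `I`, and a
  linear combination of short runs can only lie in `I` if it is zero. The special role of the
  vertices with `val(α) = 1` in the relations of type three is that of making consecutive arrows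
  exactly those whose product is not such a relation (`isSubpath_specialCycle_or_iff`).
* Counting (`card_runData`): a short run from `v` to `w` is determined by `α`, an occurrence of `V` in
  the successor sequence at `α`, and its length, which ranges over the `n < μ(α) val(α)` for which
  the run ends at `W`. In each of the `μ(α)` turns around the cyclic order `W` is met `occ(α, W)`
  times.
-/

namespace BrauerConfiguration

variable {Γ₀ Γ₁ : Type*} [Fintype Γ₀] [DecidableEq Γ₀] [Fintype Γ₁] [DecidableEq Γ₁]
variable {Γ : BrauerConfiguration Γ₀ Γ₁}

/-! ### Paths of the induced quiver as lists of arrows -/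

/-- The list of the arrows of a path, in the order in which the path runs through them. -/
def arrows {v : Γ.QVertex} : {w : Γ.QVertex} → Quiver.Path v w → List Γ.Arrow
  | _, .nil => []
  | _, .cons p e => arrows p ++ [e.1]

@[simp] theorem arrows_nil (v : Γ.QVertex) : arrows (.nil : Quiver.Path v v) = [] := rfl

@[simp] theorem arrows_cons {u v w : Γ.QVertex} (p : Quiver.Path u v) (e : v ⟶ w) :
    arrows (p.cons e) = arrows p ++ [e.1] := rfl

@[simp] theorem arrows_toPath {v w : Γ.QVertex} (e : v ⟶ w) : arrows e.toPath = [e.1] := rfl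

@[simp] theorem arrows_comp {u v w : Γ.QVertex} (p : Quiver.Path u v) (q : Quiver.Path v w) :
    arrows (p.comp q) = arrows p ++ arrows q := by
  induction q with
  | nil => simp
  | cons q e ih => simp [ih]

theorem arrows_injective {v w : Γ.QVertex} {p q : Quiver.Path v w}
    (h : arrows p = arrows q) : p = q := by
  induction p with
  | nil =>
    cases q with
    | nil => rfl
    | cons q e => simp at h
  | cons p e ih =>
    cases q with
    | nil => simp at h
    | cons q f =>
      rw [arrows_cons, arrows_cons] at h
      obtain ⟨h₁, h₂⟩ := List.append_inj' h rfl
      obtain ⟨e, rfl, he⟩ := e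
      obtain ⟨f, rfl, hf⟩ := f
      simp only [List.cons.injEq, and_true] at h₂
      subst h₂
      rw [ih h₁]

theorem eq_of_arrows_eq_nil {v w : Γ.QVertex} (p : Quiver.Path v w) (h : arrows p = []) :
    v = w := by
  cases p with
  | nil => rfl
  | cons p e => simp at h

theorem eq_target_of_arrows_eq_append {v w : Γ.QVertex} (p : Quiver.Path v w) {L : List Γ.Arrow}
    {a : Γ.Arrow} (h : arrows p = L ++ [a]) : w = Γ.toQVertex a.target := by
  cases p with
  | nil => simp at h
  | cons p e =>
    have := (List.append_inj' h rfl).2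
    simp only [List.cons.injEq, and_true] at this
    rw [← this, e.2.2]

theorem eq_source_of_arrows_eq_cons {v w : Γ.QVertex} (p : Quiver.Path v w) {L : List Γ.Arrow}
    {a : Γ.Arrow} (h : arrows p = a :: L) : v = Γ.toQVertex a.source := by
  induction p generalizing L with
  | nil => simp at h
  | cons p e ih =>
    rw [arrows_cons] at h
    cases hp : arrows p with
    | nil =>
      rw [hp] at h
      cases p with
      | nil =>
        simp only [List.nil_append, List.cons.injEq] at h
        rw [← h.1, e.2.1]
      | cons p f => simp at hp
    | cons b L' =>
      rw [hp, List.cons_append, List.cons.injEq] at h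
      exact ih (h.1 ▸ hp)

/-- A path can be cut wherever its list of arrows is cut. -/
theorem exists_eq_comp_of_arrows_eq_append {v w : Γ.QVertex} (p : Quiver.Path v w)
    {L L' : List Γ.Arrow} (h : arrows p = L ++ L') :
    ∃ (u : Γ.QVertex) (q : Quiver.Path v u) (r : Quiver.Path u w),
      p = q.comp r ∧ arrows q = L ∧ arrows r = L' := by
  induction p generalizing L' with
  | nil =>
    obtain ⟨rfl, rfl⟩ := List.append_eq_nil_iff.1 h.symm
    exact ⟨_, .nil, .nil, rfl, rfl, rfl⟩
  | cons p e ih =>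
    rcases L'.eq_nil_or_concat with rfl | ⟨L', a, rfl⟩
    · exact ⟨_, p.cons e, .nil, rfl, by simpa using h, rfl⟩
    · rw [arrows_cons, List.concat_eq_append, ← List.append_assoc] at h
      obtain ⟨h₁, h₂⟩ := List.append_inj' h rfl
      obtain ⟨u, q, r, rfl, hq, hr⟩ := ih h₁
      exact ⟨u, q, r.cons e, rfl, hq, by simp [hr, h₂]⟩

/-! ### Runs of consecutive arrows -/

theorem Arrow.nextN_add (a : Γ.Arrow) (m n : ℕ) : a.nextN (m + n) = (a.nextN m).nextN n := by
  induction n with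
  | zero => rfl
  | succ n ih => rw [← Nat.add_assoc, nextN, nextN, ih]

theorem Arrow.nextN_mul_val (a : Γ.Arrow) (m : ℕ) : a.nextN (m * Γ.val a.vertex) = a := by
  induction m with
  | zero => simp [nextN]
  | succ m ih => rw [Nat.succ_mul, nextN_add, ih, nextN_val]

theorem Arrow.next_eq_self (a : Γ.Arrow) (h : Γ.val a.vertex = 1) : a.next = a := by
  simpa [h, nextN] using a.nextN_val

theorem Arrow.val_pos (a : Γ.Arrow) : 0 < Γ.val a.vertex := by
  rw [← Γ.length_succSeq]
  exact a.pos.pos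

theorem Arrow.mult_mul_val_pos (a : Γ.Arrow) : 0 < Γ.mult a.vertex * Γ.val a.vertex :=
  Nat.mul_pos (Γ.mult_pos _) a.val_pos

/-- The list of `n` consecutive arrows, the first one being `a`. -/
def runList (a : Γ.Arrow) (n : ℕ) : List Γ.Arrow := (List.range n).map a.nextN

@[simp] theorem length_runList (a : Γ.Arrow) (n : ℕ) : (runList a n).length = n := by
  simp [runList]

theorem runList_add (a : Γ.Arrow) (m n : ℕ) :
    runList a (m + n) = runList a m ++ runList (a.nextN m) n := by
  simp only [runList, List.range_add, List.map_append, List.map_map]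
  congr 2
  funext i
  exact a.nextN_add m i

theorem runList_succ' (a : Γ.Arrow) (n : ℕ) :
    runList a (n + 1) = runList a n ++ [a.nextN n] := by
  rw [runList_add]; rfl

theorem runList_succ (a : Γ.Arrow) (n : ℕ) :
    runList a (n + 1) = a :: runList a.next n := by
  rw [Nat.add_comm, runList_add]; rfl

theorem mem_runList_self (a : Γ.Arrow) {n : ℕ} (hn : 0 < n) : a ∈ runList a n := by
  obtain ⟨n, rfl⟩ := Nat.exists_eq_succ_of_ne_zero hn.ne'
  simp [runList_succ]

theorem vertex_of_mem_runList {a b : Γ.Arrow} {n : ℕ} (h : b ∈ runList a n) :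
    b.vertex = a.vertex := by
  obtain ⟨i, -, rfl⟩ := List.mem_map.1 h
  exact a.nextN_vertex i

theorem isChain_runList (a : Γ.Arrow) (n : ℕ) :
    (runList a n).IsChain (fun b c => c = b.next) := by
  induction n generalizing a with
  | zero => exact .nil
  | succ n ih =>
    rw [runList_succ]
    cases n with
    | zero => exact .singleton a
    | succ n =>
      have := ih a.next
      rw [runList_succ] at this ⊢
      exact .cons_cons rfl this

theorem eq_runList_of_isChain {a : Γ.Arrow} {L : List Γ.Arrow}
    (h : (a :: L).IsChain (fun b c => c = b.next)) : a :: L = runList a (L.length + 1) := by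
  induction L generalizing a with
  | nil => rfl
  | cons b L ih =>
    obtain ⟨rfl, h⟩ := List.isChain_cons_cons.1 h
    rw [List.length_cons, runList_succ a, ← ih h]

@[simp] theorem arrows_run (a : Γ.Arrow) (n : ℕ) : arrows (a.run n) = runList a n := by
  induction n with
  | zero => rfl
  | succ n ih =>
    change arrows (a.run n) ++ [a.nextN n] = _
    rw [ih, runList_succ']

/-- The arrow lists of short runs: the arrows are consecutive arrows at one vertex `α`, and there
are less than `μ(α) val(α)` of them. The empty list is included; for the other lists, `α` can be read
off from any of the arrows. -/
def IsShortRun (L : List Γ.Arrow) : Prop :=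
  L.IsChain (fun a b => b = a.next) ∧ ∀ a ∈ L, L.length < Γ.mult a.vertex * Γ.val a.vertex

theorem IsShortRun.of_infix {L L' : List Γ.Arrow} (h : IsShortRun L') (hL : L <:+: L') :
    IsShortRun L :=
  ⟨h.1.infix hL, fun a ha => hL.length_le.trans_lt (h.2 a (hL.subset ha))⟩

theorem isShortRun_runList {a : Γ.Arrow} {n : ℕ}
    (hn : n < Γ.mult a.vertex * Γ.val a.vertex) : IsShortRun (runList a n) := by
  refine ⟨isChain_runList a n, fun b hb => ?_⟩
  rwa [length_runList, vertex_of_mem_runList hb]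

theorem not_isShortRun_runList (a : Γ.Arrow) :
    ¬ IsShortRun (runList a (Γ.mult a.vertex * Γ.val a.vertex)) := fun h => by
  simpa using h.2 a (mem_runList_self a a.mult_mul_val_pos)

/-- Two composable arrows form a subpath of a special cycle, or the square of a loop which is itself
a special cycle, if and only if the second one is the successor of the first one. -/
theorem isSubpath_specialCycle_or_iff {u v w : Γ.QVertex} (a : u ⟶ v) (b : v ⟶ w) :
    ((∃ c : Γ.Arrow, Γ.IsSubpath (a.toPath.comp b.toPath) c.specialCycle) ∨
      (a.1 = b.1 ∧ Γ.val a.1.vertex = 1)) ↔ b.1 = a.1.next := by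
  constructor
  · rintro (⟨c, r, s, h⟩ | ⟨h, h'⟩)
    · have hc := isChain_runList c (Γ.val c.vertex)
      rw [← arrows_run, ← Arrow.specialCycle, h] at hc
      simp only [arrows_comp, arrows_toPath, List.append_assoc, List.cons_append,
        List.nil_append] at hc
      exact (List.isChain_append_cons_cons.1 hc).2.1
    · rw [← h, Arrow.next_eq_self _ h']
  · intro h
    by_cases h₁ : Γ.val a.1.vertex = 1
    · exact Or.inr ⟨by rw [h, Arrow.next_eq_self _ h₁], h₁⟩
    · left
      obtain ⟨a, rfl, rfl⟩ := a
      obtain ⟨b, hb, rfl⟩ := b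
      dsimp only at h h₁
      subst h
      obtain ⟨t, ht⟩ : ∃ t, Γ.val a.vertex = 2 + t :=
        Nat.exists_eq_add_of_le (by have := a.val_pos; omega)
      have hL : arrows a.specialCycle = [a, a.next] ++ runList (a.nextN 2) t := by
        rw [Arrow.specialCycle, arrows_run, ht, runList_add]; rfl
      obtain ⟨m, q, s, hqs, hq, -⟩ := exists_eq_comp_of_arrows_eq_append _ hL
      obtain rfl := eq_target_of_arrows_eq_append (L := [a]) q hq
      refine ⟨a, .nil, s, ?_⟩
      rw [hqs, Quiver.Path.nil_comp]
      congr 1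
      exact arrows_injective hq

/-! ### The ideal of relations and the paths that are not short runs -/

section Ideal

variable (K : Type*) [Field K]

open PathAlgebra

theorem ofPath_eq_of_arrows {v w v' w' : Γ.QVertex} (p : Quiver.Path v w)
    (q : Quiver.Path v' w') (hv : v = v') (hw : w = w') (h : arrows p = arrows q) :
    ofPath K p = ofPath K q := by
  subst hv hw
  rw [arrows_injective h]

theorem ofPath_mul_eq_of_arrows {u v v' w u' w' : Γ.QVertex} (p : Quiver.Path u v)
    (q : Quiver.Path v' w) (r : Quiver.Path u' w') (hu : u = u') (hv : v' = v) (hw : w = w')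
    (h : arrows r = arrows p ++ arrows q) : ofPath K p * ofPath K q = ofPath K r := by
  subst hv
  rw [ofPath_mul_ofPath]
  exact ofPath_eq_of_arrows K _ _ hu hw (by rw [arrows_comp, h])

/-- `C ^ μ(α)` is a single path. -/
theorem cyclePow_eq (a : Γ.Arrow) :
    Γ.cyclePow K a = ofPath K (a.run (Γ.mult a.vertex * Γ.val a.vertex)) := by
  have key (m : ℕ) :
      ofPath K a.specialCycle ^ (m + 1) = ofPath K (a.run ((m + 1) * Γ.val a.vertex)) := by
    induction m with
    | zero =>
      rw [zero_add, pow_one, one_mul]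
      rfl
    | succ m ih =>
      rw [pow_succ, ih]
      refine ofPath_mul_eq_of_arrows K _ _ _ rfl ?_ ?_ ?_
      · rw [a.nextN_mul_val]
      · rw [a.nextN_mul_val, a.nextN_val]
      · rw [arrows_run, arrows_run, Arrow.specialCycle, arrows_run, Nat.succ_mul (m + 1),
          runList_add, a.nextN_mul_val]
  obtain ⟨m, hm⟩ := Nat.exists_eq_succ_of_ne_zero (Γ.mult_pos a.vertex).ne'
  rw [cyclePow, hm]
  exact key m

variable (Γ) in
/-- The span of the paths that are not short runs. -/
noncomputable def longSpan : Submodule K (PathAlgebra K Γ.QVertex) :=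
  Submodule.span K (pathBasis K '' {p | ¬ IsShortRun (arrows p.2.2)})

theorem ofPath_mem_longSpan {v w : Γ.QVertex} {p : Quiver.Path v w}
    (h : ¬ IsShortRun (arrows p)) : ofPath K p ∈ Γ.longSpan K :=
  Submodule.subset_span ⟨⟨v, w, p⟩, h, rfl⟩

theorem mul_mem_longSpan_left (x : PathAlgebra K Γ.QVertex) {y : PathAlgebra K Γ.QVertex}
    (hy : y ∈ Γ.longSpan K) : x * y ∈ Γ.longSpan K := by
  induction hy using Submodule.span_induction with
  | zero => rw [mul_zero]; exact zero_mem _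
  | add y z _ _ hy hz => rw [mul_add]; exact add_mem hy hz
  | smul c y _ hy => rw [mul_smul_comm]; exact Submodule.smul_mem _ c hy
  | mem y hy =>
    obtain ⟨⟨v, w, q⟩, hq, rfl⟩ := hy
    change x * ofPath K q ∈ _
    induction x using induction_on K with
    | zero => rw [zero_mul]; exact zero_mem _
    | add x z hx hz => rw [add_mul]; exact add_mem hx hz
    | smul c x hx => rw [smul_mul_assoc]; exact Submodule.smul_mem _ c hx
    | path p =>
      obtain ⟨u, v', p⟩ := p
      change ofPath K p * _ ∈ _
      by_cases h : v = v'
      · subst h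
        rw [ofPath_mul_ofPath]
        refine ofPath_mem_longSpan K fun h' => hq (h'.of_infix ?_)
        rw [arrows_comp]
        exact (List.suffix_append _ _).isInfix
      · rw [ofPath_mul_of_ne K p q h]; exact zero_mem _

theorem mul_mem_longSpan_right {x : PathAlgebra K Γ.QVertex} (y : PathAlgebra K Γ.QVertex)
    (hx : x ∈ Γ.longSpan K) : x * y ∈ Γ.longSpan K := by
  induction hx using Submodule.span_induction with
  | zero => rw [zero_mul]; exact zero_mem _
  | add y z _ _ hy hz => rw [add_mul]; exact add_mem hy hz
  | smul c y _ hy => rw [smul_mul_assoc]; exact Submodule.smul_mem _ c hy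
  | mem x hx =>
    obtain ⟨⟨u, v, p⟩, hp, rfl⟩ := hx
    change ofPath K p * y ∈ _
    induction y using induction_on K with
    | zero => rw [mul_zero]; exact zero_mem _
    | add x z hx hz => rw [mul_add]; exact add_mem hx hz
    | smul c x hx => rw [mul_smul_comm]; exact Submodule.smul_mem _ c hx
    | path q =>
      obtain ⟨v', w, q⟩ := q
      change _ * ofPath K q ∈ _
      by_cases h : v' = v
      · subst h
        rw [ofPath_mul_ofPath]
        refine ofPath_mem_longSpan K fun h' => hp (h'.of_infix ?_)
        rw [arrows_comp]
        exact (List.prefix_append _ _).isInfix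
      · rw [ofPath_mul_of_ne K p q h]; exact zero_mem _

theorem cyclePow_mem_longSpan (a : Γ.Arrow) : Γ.cyclePow K a ∈ Γ.longSpan K := by
  rw [cyclePow_eq]
  refine ofPath_mem_longSpan K ?_
  rw [arrows_run]
  exact not_isShortRun_runList a

/-- No short run is involved in an element of the ideal of relations: both terms of a relation of
type one are too long, and the path in a relation of type two or three is not a short run either.
As subpaths of short runs are short runs, the same holds for the multiples of the relations. -/
theorem mem_longSpan_of_mem_relIdeal {x : PathAlgebra K Γ.QVertex} (hx : x ∈ Γ.relIdeal K) :
    x ∈ Γ.longSpan K := by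
  rw [relIdeal] at hx
  induction hx using TwoSidedIdeal.span_induction with
  | zero => exact zero_mem _
  | add x y _ _ hx hy => exact add_mem hx hy
  | neg x _ hx => exact neg_mem hx
  | left_absorb a x _ hx => exact mul_mem_longSpan_left K a hx
  | right_absorb b x _ hx => exact mul_mem_longSpan_right K b hx
  | mem x hx =>
    rcases hx with (⟨a, b, -, rfl⟩ | ⟨a, rfl⟩) | ⟨u, v, w, a, b, h₁, h₂, rfl⟩
    · exact sub_mem (cyclePow_mem_longSpan K a) (cyclePow_mem_longSpan K b)
    · exact mul_mem_longSpan_right K _ (cyclePow_mem_longSpan K a)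
    · refine ofPath_mem_longSpan K fun h => ?_
      have hab : b.1 = a.1.next := by
        simpa using h.1
      rcases (isSubpath_specialCycle_or_iff a b).2 hab with ⟨c, hc⟩ | h
      exacts [h₁ c hc, h₂ h]

theorem comp_comp_mem_relIdeal {t u v w : Γ.QVertex} (p : Quiver.Path t u)
    {q : Quiver.Path u v} (r : Quiver.Path v w) (hq : ofPath K q ∈ Γ.relIdeal K) :
    ofPath K (p.comp (q.comp r)) ∈ Γ.relIdeal K := by
  rw [← ofPath_mul_ofPath, ← ofPath_mul_ofPath]
  exact TwoSidedIdeal.mul_mem_left _ _ _ (TwoSidedIdeal.mul_mem_right _ _ _ hq)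

/-- A path between different vertices vanishes in the Brauer configuration algebra unless it is a
short run. Different end points are needed: the nonzero paths `C ^ μ(α)` are not short runs. -/
theorem ofPath_mem_relIdeal {v w : Γ.QVertex} (hvw : v ≠ w) (p : Quiver.Path v w)
    (hp : ¬ IsShortRun (arrows p)) : ofPath K p ∈ Γ.relIdeal K := by
  by_cases hc : (arrows p).IsChain (fun a b => b = a.next)
  · obtain ⟨b, hb, hlen⟩ : ∃ b ∈ arrows p,
        Γ.mult b.vertex * Γ.val b.vertex ≤ (arrows p).length := by
      by_contra! h
      exact hp ⟨hc, h⟩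
    obtain ⟨a, L, hL⟩ := List.exists_cons_of_ne_nil (List.ne_nil_of_mem hb)
    have hrun : arrows p = runList a (L.length + 1) := by
      rw [hL] at hc ⊢
      exact eq_runList_of_isChain hc
    have hba : b.vertex = a.vertex := vertex_of_mem_runList (hrun ▸ hb)
    rw [hba, hrun, length_runList] at hlen
    obtain rfl := eq_source_of_arrows_eq_cons p hL
    have hw : w = Γ.toQVertex (a.nextN (L.length + 1)).source :=
      eq_target_of_arrows_eq_append p (hrun.trans (runList_succ' a _))
    -- A run of length exactly `μ(α) val(α)` would be closed, so there is at least one more arrow.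
    have hne : Γ.mult a.vertex * Γ.val a.vertex ≠ L.length + 1 := by
      intro h
      rw [← h, a.nextN_mul_val] at hw
      exact hvw hw.symm
    obtain ⟨d, hd⟩ : ∃ d, L.length + 1 = Γ.mult a.vertex * Γ.val a.vertex + 1 + d :=
      Nat.exists_eq_add_of_le (by omega)
    rw [hd, runList_add] at hrun
    obtain ⟨m, q, r, rfl, hq, -⟩ := exists_eq_comp_of_arrows_eq_append p hrun
    have hq' : ofPath K q ∈ Γ.relIdeal K := by
      refine TwoSidedIdeal.subset_span (Or.inl (Or.inr ⟨a, ?_⟩))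
      rw [runList_succ', a.nextN_mul_val] at hq
      rw [cyclePow_eq]
      symm
      refine ofPath_mul_eq_of_arrows K _ _ _ rfl ?_ ?_ ?_
      · rw [a.nextN_mul_val]
      · exact (eq_target_of_arrows_eq_append q hq).symm
      · rw [hq, arrows_run]; rfl
    rw [← Quiver.Path.nil_comp (q.comp r)]
    exact comp_comp_mem_relIdeal K _ r hq'
  · rw [List.isChain_iff_forall_rel_of_append_cons_cons] at hc
    push Not at hc
    obtain ⟨a, b, L₁, L₂, hL, hab⟩ := hc
    obtain ⟨u₁, p₁, p', rfl, -, hp'⟩ := exists_eq_comp_of_arrows_eq_append p hL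
    obtain ⟨u₂, q, r, rfl, hq, -⟩ :=
      exists_eq_comp_of_arrows_eq_append (L := [a, b]) p' hp'
    refine comp_comp_mem_relIdeal K _ r (TwoSidedIdeal.subset_span (Or.inr ?_))
    rcases q with _ | ⟨_ | ⟨_ | _, e⟩, f⟩
    · simp at hq
    · simp at hq
    · simp only [arrows_cons, arrows_nil, List.nil_append, List.cons_append, List.cons.injEq,
        and_true] at hq
      obtain ⟨rfl, rfl⟩ := hq
      have := mt (isSubpath_specialCycle_or_iff e f).1 hab
      push Not at this
      exact ⟨_, _, _, e, f, this.1, fun h => this.2 h.1 h.2, rfl⟩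
    · have := congrArg List.length hq
      simp at this

end Ideal

/-! ### A basis of the corner -/

section Basis

variable (K : Type*) [Field K]

open PathAlgebra

variable (Γ) in
/-- The type of short runs from `V` to `W`, as paths of the induced quiver. -/
abbrev ShortRun (V W : Γ₁) :=
  {p : Quiver.Path (Γ.toQVertex V) (Γ.toQVertex W) // IsShortRun (arrows p)}

variable (Γ) in
/-- The quotient map from the path algebra to the Brauer configuration algebra. -/
noncomputable def quotMap : PathAlgebra K Γ.QVertex →ₗ[K] Γ.BrauerAlgebra K :=
  (Ideal.Quotient.mkₐ K (Γ.relIdeal K).asIdeal).toLinearMap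

theorem quotMap_eq_zero {x : PathAlgebra K Γ.QVertex} :
    Γ.quotMap K x = 0 ↔ x ∈ Γ.relIdeal K :=
  Ideal.Quotient.eq_zero_iff_mem.trans TwoSidedIdeal.mem_asIdeal

theorem quotMap_mul (x y : PathAlgebra K Γ.QVertex) :
    Γ.quotMap K (x * y) = Γ.quotMap K x * Γ.quotMap K y :=
  map_mul (Ideal.Quotient.mkₐ K (Γ.relIdeal K).asIdeal) x y

/-- The class of a short run in the Brauer configuration algebra. -/
noncomputable def ShortRun.toAlgebra {V W : Γ₁} (p : Γ.ShortRun V W) : Γ.BrauerAlgebra K :=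
  Γ.quotMap K (ofPath K p.1)

theorem linearIndependent_toAlgebra (V W : Γ₁) :
    LinearIndependent K (ShortRun.toAlgebra K : Γ.ShortRun V W → Γ.BrauerAlgebra K) := by
  let f : Γ.ShortRun V W → Quiver.AnyPath Γ.QVertex := fun p => ⟨_, _, p.1⟩
  have hf : Function.Injective f := fun p q h => by
    simpa [f, Subtype.ext_iff] using h
  refine ((pathBasis K).linearIndependent.comp f hf).map (f := Γ.quotMap K) ?_
  have hdisj : Disjoint (Set.range f) {p | ¬ IsShortRun (arrows p.2.2)} := by
    rw [Set.disjoint_left]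
    rintro _ ⟨p, rfl⟩ h
    exact h p.2
  have := (pathBasis K).linearIndependent.disjoint_span_image hdisj
  rw [← Set.range_comp] at this
  refine this.mono_right fun x hx => ?_
  exact mem_longSpan_of_mem_relIdeal K ((quotMap_eq_zero K).1 hx)

theorem span_range_toAlgebra {V W : Γ₁} (hVW : V ≠ W) :
    Submodule.span K (Set.range (ShortRun.toAlgebra K : Γ.ShortRun V W → Γ.BrauerAlgebra K)) =
      Γ.corner K V W := by
  have hidem (V : Γ₁) : Γ.idem K V =
      Γ.quotMap K (ofPath K (.nil : Quiver.Path (Γ.toQVertex V) _)) := rfl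
  apply le_antisymm
  · rw [Submodule.span_le]
    rintro _ ⟨p, rfl⟩
    refine ⟨p.toAlgebra K, ?_⟩
    rw [LinearMap.mulLeftRight_apply, hidem, hidem, ShortRun.toAlgebra, ← quotMap_mul,
      ← quotMap_mul, ofPath_mul_ofPath, ofPath_mul_ofPath, Quiver.Path.nil_comp,
      Quiver.Path.comp_nil]
  · rintro _ ⟨x, rfl⟩
    obtain ⟨x, rfl⟩ : ∃ y, Γ.quotMap K y = x := Ideal.Quotient.mk_surjective x
    rw [LinearMap.mulLeftRight_apply, hidem, hidem, ← quotMap_mul, ← quotMap_mul]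
    induction x using induction_on K with
    | zero => rw [mul_zero, zero_mul, map_zero]; exact zero_mem _
    | add x y hx hy => rw [mul_add, add_mul, map_add]; exact add_mem hx hy
    | smul c x hx =>
      rw [mul_smul_comm, smul_mul_assoc, map_smul]; exact Submodule.smul_mem _ c hx
    | path p =>
      obtain ⟨v, w, p⟩ := p
      change Γ.quotMap K (_ * ofPath K p * _) ∈ _
      by_cases hv : Γ.toQVertex V = v
      · subst hv
        rw [ofPath_mul_ofPath, Quiver.Path.nil_comp]
        by_cases hw : Γ.toQVertex W = w
        · subst hw
          rw [ofPath_mul_ofPath, Quiver.Path.comp_nil]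
          by_cases hp : IsShortRun (arrows p)
          · exact Submodule.subset_span ⟨⟨p, hp⟩, rfl⟩
          · have hI : ofPath K p ∈ Γ.relIdeal K :=
              ofPath_mem_relIdeal (v := Γ.toQVertex V) (w := Γ.toQVertex W) K hVW p hp
            rw [(quotMap_eq_zero K).2 hI]
            exact zero_mem _
        · rw [ofPath_mul_of_ne K _ _ hw, map_zero]; exact zero_mem _
      · rw [ofPath_mul_of_ne K _ _ (Ne.symm hv), zero_mul, map_zero]; exact zero_mem _

/-- The short runs from `V` to `W` form a basis of `v Λ w`. -/
noncomputable def cornerBasis {V W : Γ₁} (hVW : V ≠ W) :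
    Module.Basis (Γ.ShortRun V W) K (Γ.corner K V W) :=
  (Module.Basis.span (linearIndependent_toAlgebra K V W)).map
    (LinearEquiv.ofEq _ _ (span_range_toAlgebra K hVW))

end Basis

/-! ### Counting the short runs -/

theorem card_filter_get_eq_count {ι : Type*} [DecidableEq ι] (l : List ι) (x : ι) :
    (Finset.univ.filter fun j : Fin l.length => l.get j = x).card = l.count x := by
  have h : l.count x = (List.ofFn l.get).count x := by rw [List.ofFn_get]
  rw [h, ← Multiset.coe_count, ← Fin.univ_val_map, Multiset.count_map, Finset.card,
    Finset.filter_val]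
  simp only [eq_comm]

/-- In `m` turns of a cyclic list, started at any position `j`, each term `x` of the list is met
`m` times as often as it occurs in the list. -/
theorem count_get_add_mod {ι : Type*} [DecidableEq ι] (l : List ι) (hl : 0 < l.length) (x : ι)
    (j m : ℕ) : Nat.count (fun n => l.get ⟨(j + n) % l.length, Nat.mod_lt _ hl⟩ = x)
      (m * l.length) = m * l.count x := by
  set p : ℕ → Prop := fun n => l.get ⟨n % l.length, Nat.mod_lt _ hl⟩ = x with hp
  have hper : Function.Periodic p l.length := fun n => by simp [hp]
  have hzero : Nat.count p l.length = l.count x := by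
    rw [← card_filter_get_eq_count, Nat.count_eq_card_filter_range]
    symm
    refine Finset.card_bij (fun j _ => j.1) ?_ ?_ ?_
    · intro i hi
      simpa [hp, Nat.mod_eq_of_lt i.2] using hi
    · intro i _ i' _ h
      exact Fin.ext h
    · intro n hn
      simp only [Finset.mem_filter, Finset.mem_range] at hn
      refine ⟨⟨n, hn.1⟩, ?_, rfl⟩
      simpa [hp, Nat.mod_eq_of_lt hn.1] using hn.2
  have hturn (k : ℕ) : Nat.count (fun n => p (k + n)) l.length = l.count x := by
    rw [← hzero, ← Nat.filter_Ico_card_eq_of_periodic k _ p hper,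
      Nat.count_eq_card_filter_range, Finset.range_eq_Ico]
    refine Finset.card_bij (fun n _ => k + n) ?_ ?_ ?_
    · simp
    · simp
    · intro n hn
      simp only [Finset.mem_filter, Finset.mem_Ico] at hn
      refine ⟨n - k, ?_, by omega⟩
      simp only [Finset.mem_filter, Finset.mem_Ico]
      rw [Nat.add_sub_cancel' hn.1.1]
      exact ⟨by omega, hn.2⟩
  change Nat.count (fun n => p (j + n)) _ = _
  induction m with
  | zero => simp
  | succ m ih =>
    rw [Nat.succ_mul, Nat.count_add, ih, Nat.succ_mul]
    simp only [← Nat.add_assoc]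
    rw [hturn]

theorem mem_vertexSet_iff {α : Γ₀} {V : Γ₁} : α ∈ Γ.vertexSet V ↔ V ∈ Γ.succSeq α := by
  rw [vertexSet, Multiset.mem_toFinset, ← Multiset.count_pos, ← Γ.count_succSeq,
    List.count_pos_iff]

/-- A vertex that occurs in two different polygons is not truncated. -/
theorem not_isTruncated_of_mem {V W : Γ₁} (hVW : V ≠ W) {α : Γ₀}
    (hα : α ∈ Γ.vertexSet V ∩ Γ.vertexSet W) : ¬ Γ.IsTruncated α := by
  rintro ⟨h, -⟩
  rw [Finset.mem_inter, mem_vertexSet_iff, mem_vertexSet_iff] at hα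
  rw [← Γ.length_succSeq] at h
  obtain ⟨U, hU⟩ := List.length_eq_one_iff.1 h
  simp only [hU, List.mem_singleton] at hα
  exact hVW (hα.1.trans hα.2.symm)

variable (Γ) in
/-- The data that determine a short run from `V` to `W`: a common vertex `α`, the position of
an occurrence of `V` in the successor sequence at `α`, and the length of the run, after which `W` is
reached. -/
def runData (V W : Γ₁) : Finset (Σ α : Γ₀, Σ _ : Fin (Γ.succSeq α).length, ℕ) :=
  (Γ.vertexSet V ∩ Γ.vertexSet W).sigma fun α =>
    (Finset.univ.filter fun j => (Γ.succSeq α).get j = V).sigma fun j =>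
      (Finset.range (Γ.mult α * (Γ.succSeq α).length)).filter fun n =>
        (Γ.succSeq α).get ⟨(j + n) % (Γ.succSeq α).length, Nat.mod_lt _ j.pos⟩ = W

theorem card_runData (V W : Γ₁) : (Γ.runData V W).card =
    ∑ α ∈ Γ.vertexSet V ∩ Γ.vertexSet W, Γ.mult α * Γ.occ α V * Γ.occ α W := by
  rw [runData, Finset.card_sigma]
  refine Finset.sum_congr rfl fun α _ => ?_
  rw [Finset.card_sigma, Finset.sum_congr rfl (g := fun _ => Γ.mult α * Γ.occ α W),
    Finset.sum_const, card_filter_get_eq_count, Γ.count_succSeq, smul_eq_mul]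
  · change Γ.occ α V * _ = _
    ring
  · intro j _
    rw [← Nat.count_eq_card_filter_range, count_get_add_mod _ j.pos, Γ.count_succSeq]
    rfl

theorem mem_runData {V W : Γ₁} (a : Γ.Arrow) (n : ℕ) :
    (⟨a.vertex, a.pos, n⟩ : Σ α : Γ₀, Σ _ : Fin (Γ.succSeq α).length, ℕ) ∈ Γ.runData V W ↔
      a.source = V ∧ n < Γ.mult a.vertex * Γ.val a.vertex ∧ (a.nextN n).source = W := by
  simp only [runData, Finset.mem_sigma, Finset.mem_filter, Finset.mem_univ, true_and,
    Finset.mem_range, Finset.mem_inter, mem_vertexSet_iff, Γ.length_succSeq a.vertex,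
    a.nextN_eq n]
  constructor
  · exact fun h => h.2
  · rintro ⟨h₁, h₂, h₃⟩
    exact ⟨⟨h₁ ▸ List.get_mem _ _, h₃ ▸ List.get_mem _ _⟩, h₁, h₂, h₃⟩

theorem exists_shortRun_arrows_eq {V W : Γ₁} {a : Γ.Arrow} {n : ℕ} (hV : a.source = V)
    (hn : n < Γ.mult a.vertex * Γ.val a.vertex) (hW : (a.nextN n).source = W) :
    ∃ p : Γ.ShortRun V W, arrows p.1 = runList a n := by
  subst hV hW
  exact ⟨⟨a.run n, by rw [arrows_run]; exact isShortRun_runList hn⟩, arrows_run a n⟩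

theorem ShortRun.exists_arrows_eq {V W : Γ₁} (hVW : V ≠ W) (p : Γ.ShortRun V W) :
    ∃ (a : Γ.Arrow) (n : ℕ), arrows p.1 = runList a n ∧ a.source = V ∧
      n < Γ.mult a.vertex * Γ.val a.vertex ∧ (a.nextN n).source = W := by
  obtain ⟨p, hc, hlen⟩ := p
  cases hp : arrows p with
  | nil =>
    exact absurd (eq_of_arrows_eq_nil p hp) hVW
  | cons a L =>
    rw [hp] at hc hlen
    have hrun := eq_runList_of_isChain hc
    refine ⟨a, L.length + 1, hrun, (eq_source_of_arrows_eq_cons p hp).symm,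
      hlen a List.mem_cons_self, ?_⟩
    exact (eq_target_of_arrows_eq_append p ((hp.trans hrun).trans (runList_succ' a _))).symm

/-- Short runs between different polygons correspond to the data that determine them. -/
theorem nonempty_equiv_shortRun {V W : Γ₁} (hVW : V ≠ W) :
    Nonempty (Γ.runData V W ≃ Γ.ShortRun V W) := by
  have hnt (x : Γ.runData V W) : ¬ Γ.IsTruncated x.1.1 :=
    not_isTruncated_of_mem hVW (Finset.mem_sigma.1 x.2).1
  have hmem (x : Γ.runData V W) := (mem_runData ⟨x.1.1, hnt x, x.1.2.1⟩ x.1.2.2).1 x.2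
  choose f hf using fun x => exists_shortRun_arrows_eq (hmem x).1 (hmem x).2.1 (hmem x).2.2
  refine ⟨Equiv.ofBijective f ⟨?_, ?_⟩⟩
  · intro x y h
    have hxy := (hf x).symm.trans ((congrArg (fun p => arrows p.1) h).trans (hf y))
    have hn : x.1.2.2 = y.1.2.2 := by simpa using congrArg List.length hxy
    -- A run of length zero would be closed, so both runs have a first arrow.
    have hpos : x.1.2.2 ≠ 0 := fun h0 => by
      have := hmem x
      rw [h0] at this
      exact hVW (this.1.symm.trans this.2.2)
    obtain ⟨⟨α, j, n⟩, hx⟩ := x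
    obtain ⟨⟨β, k, m⟩, hy⟩ := y
    dsimp only at hn hpos hxy
    subst hn
    obtain ⟨n, rfl⟩ := Nat.exists_eq_succ_of_ne_zero hpos
    rw [runList_succ, runList_succ, List.cons.injEq, Arrow.mk.injEq] at hxy
    obtain ⟨⟨rfl, hjk⟩, -⟩ := hxy
    obtain rfl := eq_of_heq hjk
    rfl
  · intro p
    obtain ⟨a, n, hp, ha⟩ := p.exists_arrows_eq hVW
    exact ⟨⟨⟨a.vertex, a.pos, n⟩, (mem_runData a n).2 ha⟩,
      Subtype.ext (arrows_injective ((hf _).trans hp.symm))⟩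

end BrauerConfiguration

theorem proposition018 {Γ₀ Γ₁ : Type*} [Fintype Γ₀] [DecidableEq Γ₀] [Fintype Γ₁] [DecidableEq Γ₁]
    (Γ : BrauerConfiguration Γ₀ Γ₁) (K : Type*) [Field K] (V W : Γ₁) (hVW : V ≠ W) :
    Module.Finite K (Γ.corner K V W) ∧
      Module.finrank K (Γ.corner K V W) =
        ∑ α ∈ Γ.vertexSet V ∩ Γ.vertexSet W, Γ.mult α * Γ.occ α V * Γ.occ α W := by
  obtain ⟨e⟩ := BrauerConfiguration.nonempty_equiv_shortRun (Γ := Γ) hVW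
  let b := (BrauerConfiguration.cornerBasis (Γ := Γ) K hVW).reindex e.symm
  refine ⟨Module.Finite.of_basis b, ?_⟩
  rw [Module.finrank_eq_card_basis b, Fintype.card_coe, BrauerConfiguration.card_runData]
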